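/- Let $n \ge 1$, let $t_1,\ldots,t_n$ be distinct real numbers and let $\lambda > 0$. Let $B = \big[e^{-\lambda (t_j-t_i)^2/2}\big]_{i,j=1,\ldots,n}$ be the univariate Gaussian matrix, and put $$ V(\mathbf{t}) = \prod_{1\le i<j\le n}(t_j-t_i), \qquad c_n = \prod_{i=1}^{n-1} i!, \qquad N = \binom{n}{2}, \qquad \overline{t} = \frac1n\sum_{i=1}^n t_i, \qquad S = \sum_{i=1}^n (t_i-\overline{t})^2. $$ Then $$ \frac{\lambda^N}{c_n}\, V(\mathbf{t})^2 e^{-\lambda S} \;\le\; \det(B) \;\le\; \frac{\lambda^N}{c_n}\, V(\mathbf{t})^2 . $$ -/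

import Mathlib

noncomputable section

/-- The Vandermonde polynomial `V(t) = ∏_{i < j} (t_j - t_i)`. -/
def vandermondePoly {n : ℕ} (t : Fin n → ℝ) : ℝ :=
  ∏ i : Fin n, ∏ j ∈ Finset.Ioi i, (t j - t i)

/-- The constant `c_n = ∏_{i=1}^{n-1} i!`. -/
def cConst (n : ℕ) : ℝ :=
  ∏ i ∈ Finset.Icc 1 (n - 1), (Nat.factorial i : ℝ)

/-- The univariate Gaussian matrix `B = [exp (-λ (t_j - t_i)² / 2)]`. -/
def gaussianMatrix {n : ℕ} (lam : ℝ) (t : Fin n → ℝ) : Matrix (Fin n) (Fin n) ℝ :=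
  Matrix.of fun i j => Real.exp (-lam * (t j - t i) ^ 2 / 2)

/-- The mean of `t_1, …, t_n`. -/
def nodeMean {n : ℕ} (t : Fin n → ℝ) : ℝ :=
  (1 / (n : ℝ)) * ∑ i : Fin n, t i

/-- The sum of squared deviations from the mean, `S = ∑ (t_i - mean)²`. -/
def sumSqDev {n : ℕ} (t : Fin n → ℝ) : ℝ :=
  ∑ i : Fin n, (t i - nodeMean t) ^ 2

end

/-! Upper bound: with y = √λ t, B is the Gram matrix of the characters e^{i s y_j} under the
standard Gaussian, so by Andréief n! det B is the Gaussian mean of |det e^{i s_k y_j}|². Each such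
determinant is at most |V(s)||V(y)|/c_n (`norm_det_exp_le`), and V(s)² has mean n! c_n by
orthogonality of the Hermite polynomials.

Lower bound: centring at u_i = t_i - mean and pulling e^{-λu_i²/2} out of rows and columns leaves
e^{λ u_i u_j}, whose Taylor series is a sum of positive semidefinite matrices. The first n terms
form M Mᵀ with M a scaled Vandermonde matrix, and adding the rest does not decrease the determinant.
-/

open MeasureTheory Matrix Polynomial ProbabilityTheory

/-! ### Determinants, integrals and positivity -/

/-- The determinant of a matrix of integrals, with one measure per row, is the integral of the
determinant over the product measure. -/
theorem Matrix.det_of_integral {ι α 𝕜 : Type*} [Fintype ι] [DecidableEq ι] [RCLike 𝕜]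
    [MeasurableSpace α] (μ : ι → Measure α) [∀ i, SigmaFinite (μ i)] (f : ι → α → 𝕜)
    (hf : ∀ i j, Integrable (f j) (μ i)) :
    Integrable (fun s : ι → α => (Matrix.of fun i j => f j (s i)).det) (Measure.pi μ) ∧
    ∫ s, (Matrix.of fun i j => f j (s i)).det ∂(Measure.pi μ) =
      (Matrix.of fun i j => ∫ a, f j a ∂(μ i)).det := by
  have h1 : ∀ σ : Equiv.Perm ι, Integrable
      (fun s : ι → α => ((Equiv.Perm.sign σ : ℤ) : 𝕜) * ∏ i, f (σ i) (s i)) (Measure.pi μ) :=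
    fun σ => (Integrable.fintype_prod (f := fun i => f (σ i)) fun i => hf i (σ i)).const_mul _
  constructor
  · simp_rw [← det_transpose (Matrix.of _), det_apply']
    exact integrable_finsetSum _ fun σ _ => h1 σ
  · simp_rw [← det_transpose (Matrix.of _), det_apply', transpose_apply, of_apply]
    rw [integral_finsetSum _ fun σ _ => h1 σ]
    refine Finset.sum_congr rfl fun σ _ => ?_
    rw [integral_const_mul, integral_fintype_prod_eq_prod (f := fun i => f (σ i))]

/-- **Andréief's identity**. -/
theorem Matrix.integral_det_mul_det {ι α 𝕜 : Type*} [Fintype ι] [DecidableEq ι] [RCLike 𝕜]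
    [MeasurableSpace α] (μ : Measure α) [SigmaFinite μ] (f g : ι → α → 𝕜)
    (hfg : ∀ i j, Integrable (fun a => f i a * g j a) μ) :
    Integrable (fun s : ι → α => (Matrix.of fun i j => f j (s i)).det *
        (Matrix.of fun i j => g j (s i)).det) (Measure.pi fun _ => μ) ∧
    ∫ s, (Matrix.of fun i j => f j (s i)).det * (Matrix.of fun i j => g j (s i)).det
        ∂(Measure.pi fun _ : ι => μ) =
      (Fintype.card ι).factorial * (Matrix.of fun i j => ∫ a, f i a * g j a ∂μ).det := by
  -- Expand only the first determinant and absorb its factors into the rows of the second; after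
  -- integration each σ gives the same Gram determinant, as the two signs cancel.
  have key : ∀ s : ι → α, (Matrix.of fun i j => f j (s i)).det *
      (Matrix.of fun i j => g j (s i)).det = ∑ σ : Equiv.Perm ι, ((Equiv.Perm.sign σ : ℤ) : 𝕜) *
        (Matrix.of fun i j => f (σ i) (s i) * g j (s i)).det := by
    intro s
    rw [← det_transpose (Matrix.of fun i j => f j (s i)), det_apply', Finset.sum_mul]
    refine Finset.sum_congr rfl fun σ _ => ?_
    rw [mul_assoc, ← det_mul_column]
    rfl
  have h1 : ∀ σ : Equiv.Perm ι, Integrable (fun s : ι → α =>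
        (Matrix.of fun i j => f (σ i) (s i) * g j (s i)).det) (Measure.pi fun _ => μ) ∧
      ∫ s, (Matrix.of fun i j => f (σ i) (s i) * g j (s i)).det ∂(Measure.pi fun _ : ι => μ) =
        ((Equiv.Perm.sign σ : ℤ) : 𝕜) * (Matrix.of fun i j => ∫ a, f i a * g j a ∂μ).det := by
    intro σ
    have h2 : ∀ τ : Equiv.Perm ι, Integrable (fun s : ι → α => ((Equiv.Perm.sign τ : ℤ) : 𝕜) *
        ∏ i, (f (σ i) (s i) * g (τ i) (s i))) (Measure.pi fun _ => μ) := fun τ =>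
      (Integrable.fintype_prod (f := fun i a => f (σ i) a * g (τ i) a)
        fun i => hfg _ _).const_mul _
    constructor
    · simp_rw [← det_transpose (Matrix.of _), det_apply', transpose_apply, of_apply]
      exact integrable_finsetSum _ fun τ _ => h2 τ
    · rw [← det_permute, ← det_transpose (submatrix _ _ _)]
      simp_rw [← det_transpose (Matrix.of _), det_apply', transpose_apply, of_apply]
      rw [integral_finsetSum _ fun σ _ => h2 σ]
      refine Finset.sum_congr rfl fun τ _ => ?_
      rw [integral_const_mul, integral_fintype_prod_eq_prod (f := fun i a => f (σ i) a * g (τ i) a)]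
      rfl
  simp_rw [key]
  refine ⟨integrable_finsetSum _ fun σ _ => (h1 σ).1.const_mul _, ?_⟩
  rw [integral_finsetSum _ fun σ _ => (h1 σ).1.const_mul _]
  simp_rw [integral_const_mul, (h1 _).2, ← mul_assoc, ← Int.cast_mul]
  simp [Fintype.card_perm, ← Units.val_mul]

/-- Subtracting from each row its predecessor turns the first column into (1, 0, …, 0). -/
theorem Matrix.det_of_col_zero_eq_one {R : Type*} [CommRing R] {n : ℕ}
    (M : Matrix (Fin (n + 1)) (Fin (n + 1)) R) (h : ∀ i, M i 0 = 1) :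
    M.det = (Matrix.of fun i j : Fin n => M i.succ j.succ - M i.castSucc j.succ).det := by
  rw [det_eq_of_forall_row_eq_smul_add_pred (A := M)
    (B := Matrix.of fun i j => Fin.cases (M 0 j) (fun i => M i.succ j - M i.castSucc j) i)
    (fun _ => 1) (fun j => by simp) (fun i j => by simp), det_succ_column_zero,
    Fin.sum_univ_succ, Finset.sum_eq_zero]
  · simp [h, submatrix]
  · intro i _
    simp [h]

/-- On a unit eigenvector v, the eigenvalue of 1 + Q is 1 + vᵀQv ≥ 1. -/
theorem Matrix.PosSemidef.one_le_det_one_add {ι : Type*} [Fintype ι] [DecidableEq ι]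
    {Q : Matrix ι ι ℝ} (hQ : Q.PosSemidef) : 1 ≤ (1 + Q).det := by
  have hH : (1 + Q).IsHermitian := isHermitian_one.add hQ.isHermitian
  rw [hH.det_eq_prod_eigenvalues]
  refine Finset.one_le_prod fun i => ?_
  have h0 := hQ.dotProduct_mulVec_nonneg (hH.eigenvectorBasis i)
  have h1 : star (hH.eigenvectorBasis i).ofLp ⬝ᵥ (hH.eigenvectorBasis i).ofLp = 1 := by
    rw [dotProduct_comm, ← EuclideanSpace.inner_eq_star_dotProduct, inner_self_eq_norm_sq_to_K,
      hH.eigenvectorBasis.orthonormal.1 i]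
    simp
  have h2 := hH.eigenvalues_eq i
  rw [add_mulVec, one_mulVec, dotProduct_add, h1] at h2
  rw [h2]
  simpa using h0

/-! ### Hermite polynomials and the Gaussian mean of V² -/

theorem integrable_polynomial_eval_gaussianReal (p : ℝ[X]) :
    Integrable (fun x => p.eval x) (gaussianReal 0 1) := by
  simp_rw [Polynomial.eval_eq_sum_range]
  refine integrable_finsetSum _ fun i _ => Integrable.const_mul ?_ _
  have := (memLp_id_gaussianReal (μ := 0) (v := 1) (i : NNReal)).integrable_norm_pow'
  refine (integrable_norm_iff (by fun_prop)).1 ?_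
  simpa using this

/-- **Stein's identity** for polynomials: Gaussian integration by parts. -/
theorem integral_mul_polynomial_eval_gaussianReal (p : ℝ[X]) :
    ∫ x, x * p.eval x ∂(gaussianReal 0 1) = ∫ x, p.derivative.eval x ∂(gaussianReal 0 1) := by
  have hInt' : ∀ p : ℝ[X], Integrable (fun x => p.eval x * gaussianPDFReal 0 1 x) := by
    intro p
    have h := integrable_polynomial_eval_gaussianReal p
    rw [gaussianReal_of_var_ne_zero 0 one_ne_zero, integrable_withDensity_iff_integrable_smul'
      (measurable_gaussianPDF 0 1) (by simp [gaussianPDF_lt_top])] at h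
    simpa [toReal_gaussianPDF, mul_comm] using h
  have hd : ∀ x : ℝ, HasDerivAt (gaussianPDFReal 0 1) (-x * gaussianPDFReal 0 1 x) x := by
    intro x
    have hpdf : gaussianPDFReal 0 1 = fun y => (√(2 * Real.pi))⁻¹ * Real.exp (-(y ^ 2) / 2) := by
      rw [gaussianPDFReal_def]; simp
    have := (((hasDerivAt_pow 2 x).fun_neg.div_const 2).exp).const_mul (√(2 * Real.pi))⁻¹
    rw [hpdf]
    refine this.congr_deriv ?_
    push_cast
    ring
  rw [integral_gaussianReal_eq_integral_smul one_ne_zero,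
    integral_gaussianReal_eq_integral_smul one_ne_zero]
  have := integral_mul_deriv_eq_deriv_mul_of_integrable (u := fun x => p.eval x)
    (u' := fun x => p.derivative.eval x) (v := gaussianPDFReal 0 1)
    (v' := fun x => -x * gaussianPDFReal 0 1 x) (fun x _ => p.hasDerivAt x) (fun x _ => hd x)
    (by refine (hInt' (-(X * p))).congr (.of_forall fun x => ?_); simp; ring) (hInt' _) (hInt' _)
  calc ∫ x, gaussianPDFReal 0 1 x • (x * p.eval x)
      = -∫ x, p.eval x * (-x * gaussianPDFReal 0 1 x) := by
        rw [← integral_neg]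
        exact integral_congr_ae (.of_forall fun x => by simp only [smul_eq_mul]; ring)
    _ = ∫ x, p.derivative.eval x * gaussianPDFReal 0 1 x := by rw [this, neg_neg]
    _ = _ := by simp only [smul_eq_mul, mul_comm]

/-- Since H_{n+1} = X H_n - H_n', Stein's identity moves one derivative onto q at each step. -/
theorem integral_hermite_mul (n : ℕ) (q : ℝ[X]) :
    ∫ x, (((hermite n).map (Int.castRingHom ℝ)) * q).eval x ∂(gaussianReal 0 1) =
      ∫ x, (derivative^[n] q).eval x ∂(gaussianReal 0 1) := by
  induction n generalizing q with
  | zero => simp [hermite]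
  | succ n ih =>
    set H := (hermite n).map (Int.castRingHom ℝ) with hH
    have h1 : (hermite (n + 1)).map (Int.castRingHom ℝ) * q
        = X * (H * q) - derivative H * q := by
      simp [hermite_succ, hH, derivative_map]; ring
    have h2 := integral_mul_polynomial_eval_gaussianReal (H * q)
    have h3 : ∫ x, (X * (H * q)).eval x ∂(gaussianReal 0 1)
        = ∫ x, (derivative (H * q)).eval x ∂(gaussianReal 0 1) := by
      rw [← h2]; simp
    simp_rw [h1, eval_sub]
    have hInt := integrable_polynomial_eval_gaussianReal
    rw [integral_sub (hInt _) (hInt _), h3, ← integral_sub (hInt _) (hInt _)]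
    simp_rw [← eval_sub, derivative_mul, add_sub_cancel_left]
    rw [ih, Function.iterate_succ_apply]

theorem integral_hermite_mul_hermite (m n : ℕ) :
    ∫ x, ((hermite m).map (Int.castRingHom ℝ)).eval x *
      ((hermite n).map (Int.castRingHom ℝ)).eval x ∂(gaussianReal 0 1) =
      if m = n then (m.factorial : ℝ) else 0 := by
  have hdeg : ∀ n, ((hermite n).map (Int.castRingHom ℝ)).natDegree = n := fun n => by
    rw [(hermite_monic n).natDegree_map, natDegree_hermite]
  have hlt : ∀ m n : ℕ, n < m → ∫ x, ((hermite m).map (Int.castRingHom ℝ)).eval x *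
      ((hermite n).map (Int.castRingHom ℝ)).eval x ∂(gaussianReal 0 1) = 0 := by
    intro m n h
    simp_rw [← eval_mul]
    rw [integral_hermite_mul, iterate_derivative_eq_zero (by rwa [hdeg])]
    simp
  rcases lt_trichotomy m n with h | rfl | h
  · rw [if_neg h.ne]
    exact (integral_congr_ae (.of_forall fun x => mul_comm _ _)).trans (hlt n m h)
  · rw [if_pos rfl]
    simp_rw [← eval_mul]
    rw [integral_hermite_mul]
    have : derivative^[m] ((hermite m).map (Int.castRingHom ℝ)) = C (m.factorial : ℝ) := by
      rw [eq_C_of_natDegree_le_zero ((natDegree_iterate_derivative _ _).trans (by rw [hdeg]; simp)),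
        coeff_iterate_derivative]
      simp [Nat.descFactorial_self]
    simp [this]
  · rw [if_neg h.ne', hlt m n h]

/-- Monic Hermite polynomials give the same determinant as the monomials; Andréief's Gram matrix is
then diagonal. -/
theorem integral_det_vandermonde_sq (n : ℕ) :
    Integrable (fun s : Fin n → ℝ => (vandermonde s).det ^ 2)
      (Measure.pi fun _ => gaussianReal 0 1) ∧
    ∫ s, (vandermonde s).det ^ 2 ∂(Measure.pi fun _ : Fin n => gaussianReal 0 1) =
      n.factorial * ∏ i : Fin n, ((i : ℕ).factorial : ℝ) := by
  let H : Fin n → ℝ[X] := fun i => (hermite i).map (Int.castRingHom ℝ)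
  have hV : ∀ s : Fin n → ℝ, (vandermonde s).det = (Matrix.of fun i j => (H j).eval (s i)).det :=
    fun s => det_eval_matrixOfPolynomials_eq_det_vandermonde s H
      (fun i => by rw [(hermite_monic i).natDegree_map, natDegree_hermite])
      (fun i => (hermite_monic i).map _)
  have := Matrix.integral_det_mul_det (gaussianReal 0 1) (fun i x => (H i).eval x)
    (fun i x => (H i).eval x)
    (fun i j => by simpa using integrable_polynomial_eval_gaussianReal (H i * H j))
  simp_rw [hV, sq]
  refine ⟨this.1, this.2.trans ?_⟩
  have hD : (Matrix.of fun i j => ∫ x, (H i).eval x * (H j).eval x ∂(gaussianReal 0 1)) =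
      diagonal fun i : Fin n => ((i : ℕ).factorial : ℝ) := by
    ext i j
    simp [H, integral_hermite_mul_hermite, diagonal_apply, Fin.ext_iff]
  rw [hD, det_diagonal, Fintype.card_fin]

/-! ### Determinants of characters against Vandermonde determinants -/

/-- Row differences of x^{j+1} are (j+1)∫ s^j, and the factors j+1 multiply to n!. This is the
recursion that the bound on exponential determinants must match. -/
theorem vandermonde_succ_det_eq_integral {n : ℕ} (x : Fin (n + 1) → ℝ) (hx : Monotone x) :
    Integrable (fun s : Fin n → ℝ => (vandermonde s).det)
      (Measure.pi fun k => volume.restrict (Set.Ioc (x k.castSucc) (x k.succ))) ∧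
    (vandermonde x).det = n.factorial * ∫ s, (vandermonde s).det
      ∂(Measure.pi fun k : Fin n => volume.restrict (Set.Ioc (x k.castSucc) (x k.succ))) := by
  have h := det_of_integral (fun k : Fin n => volume.restrict (Set.Ioc (x k.castSucc) (x k.succ)))
    (fun (j : Fin n) (s : ℝ) => s ^ (j : ℕ))
    (fun i j => ((continuous_pow _).integrableOn_Icc).mono_set Set.Ioc_subset_Icc_self)
  refine ⟨h.1, ?_⟩
  have h2 : (∫ s, (vandermonde s).det
      ∂(Measure.pi fun k : Fin n => volume.restrict (Set.Ioc (x k.castSucc) (x k.succ)))) = _ := h.2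
  have h3 : (n.factorial : ℝ) = ∏ j : Fin n, ((j : ℝ) + 1) := by
    rw [Fin.prod_univ_eq_prod_range (fun j : ℕ => (j : ℝ) + 1),
      ← Finset.prod_range_add_one_eq_factorial]
    push_cast
    rfl
  rw [h2, det_of_col_zero_eq_one _ (by simp [vandermonde_apply]), h3, ← det_mul_row]
  congr 1
  ext i j
  simp only [of_apply, vandermonde_apply]
  rw [← intervalIntegral.integral_of_le (hx (Fin.castSucc_lt_succ).le), integral_pow]
  simp only [Fin.val_succ]
  field_simp

theorem det_vandermonde_eq_prod_sub_mul {R : Type*} [CommRing R] {n : ℕ} (y : Fin (n + 1) → R) :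
    (vandermonde y).det = (∏ j : Fin n, (y j.succ - y 0)) *
      (vandermonde fun j : Fin n => y j.succ - y 0).det := by
  rw [det_vandermonde_sub (fun j : Fin n => y j.succ), det_vandermonde, det_vandermonde,
    Fin.prod_univ_succ]
  simp [Fin.prod_Ioi_succ]

/-- By induction on `n`: after normalising the first column to `1`, differences of consecutive rows
are integrals over the intervals `(x k, x (k + 1)]`, and so are those of the Vandermonde matrix. -/
theorem norm_det_exp_le_of_monotone {n : ℕ} (x y : Fin n → ℝ) (hx : Monotone x) :
    ‖(Matrix.of fun i j => Complex.exp (x i * y j * Complex.I)).det‖ ≤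
      (vandermonde x).det * |(vandermonde y).det| / ∏ i : Fin n, ((i : ℕ).factorial : ℝ) := by
  induction n with
  | zero => simp
  | succ n ih =>
    set μ := fun k : Fin n => volume.restrict (Set.Ioc (x k.castSucc) (x k.succ)) with hμ
    set z : Fin n → ℝ := fun j => y j.succ - y 0 with hz
    -- Unimodular row factors make the first column 1.
    have h1 : (Matrix.of fun i j => Complex.exp (x i * y j * Complex.I)).det =
        (∏ i, Complex.exp (x i * y 0 * Complex.I)) *
          (Matrix.of fun i j => Complex.exp (x i * (y j - y 0 : ℝ) * Complex.I)).det := by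
      rw [← det_mul_column]
      congr 1
      ext i j
      simp only [of_apply, ← Complex.exp_add]
      congr 1; push_cast; ring
    have h2 : ‖∏ i, Complex.exp (x i * y 0 * Complex.I)‖ = 1 := by
      rw [norm_prod]
      exact Finset.prod_eq_one fun i _ => by
        rw [← Complex.ofReal_mul, Complex.norm_exp_ofReal_mul_I]
    have hc : ∀ j, Continuous fun s : ℝ => Complex.exp (s * z j * Complex.I) := fun j => by fun_prop
    have hdet := det_of_integral μ (fun j (s : ℝ) => Complex.exp (s * z j * Complex.I))
      (fun i j => (hc j).integrableOn_Icc.mono_set Set.Ioc_subset_Icc_self)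
    have h3 : (Matrix.of fun i j => Complex.exp (x i * (y j - y 0 : ℝ) * Complex.I)).det =
        (∏ j, ((z j : ℂ) * Complex.I)) * ∫ s, (Matrix.of fun i j =>
          Complex.exp ((s i : ℝ) * z j * Complex.I)).det ∂(Measure.pi μ) := by
      rw [det_of_col_zero_eq_one _ (by simp), hdet.2, ← det_mul_row]
      congr 1
      ext i j
      simp only [of_apply, hμ]
      rw [← intervalIntegral.integral_of_le (hx (Fin.castSucc_lt_succ).le),
        ← intervalIntegral.integral_const_mul,
        intervalIntegral.integral_eq_sub_of_hasDerivAt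
          (f := fun s : ℝ => Complex.exp (s * z j * Complex.I))]
      · intro s _
        have := (((Complex.ofRealCLM.hasDerivAt (x := s)).mul_const (z j : ℂ)).mul_const
          Complex.I).cexp
        refine this.congr_deriv ?_
        simp; ring
      · exact ((hc j).const_mul _).intervalIntegrable _ _
    obtain ⟨hVi, hV⟩ := vandermonde_succ_det_eq_integral x hx
    -- Points of consecutive intervals are ordered, so the induction hypothesis applies to s.
    have hae : ∀ᵐ s ∂(Measure.pi μ), Monotone s := by
      have : ∀ᵐ s ∂(Measure.pi μ), ∀ k, s k ∈ Set.Ioc (x k.castSucc) (x k.succ) := by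
        rw [ae_all_iff]
        exact fun k => (Measure.quasiMeasurePreserving_eval (μ := μ) k).ae
          (ae_restrict_mem measurableSet_Ioc)
      filter_upwards [this] with s hs
      intro a b hab
      rcases hab.eq_or_lt with rfl | hlt
      · exact le_rfl
      · exact (hs a).2.trans ((hx (Fin.succ_le_castSucc_iff.2 hlt)).trans (hs b).1.le)
    have h4 : ‖∫ s, (Matrix.of fun i j => Complex.exp ((s i : ℝ) * z j * Complex.I)).det
        ∂(Measure.pi μ)‖ ≤ ∫ s, (vandermonde s).det * |(vandermonde z).det| /
          ∏ i : Fin n, ((i : ℕ).factorial : ℝ) ∂(Measure.pi μ) :=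
      norm_integral_le_of_norm_le ((hVi.mul_const _).div_const _) <| by
        filter_upwards [hae] with s hs using ih s z hs
    rw [integral_div, integral_mul_const] at h4
    rw [h1, norm_mul, h2, one_mul, h3, norm_mul, norm_prod]
    simp only [norm_mul, Complex.norm_real, Complex.norm_I, mul_one, Real.norm_eq_abs]
    refine (mul_le_mul_of_nonneg_left h4 (by positivity)).trans_eq ?_
    rw [hV, det_vandermonde_eq_prod_sub_mul y, abs_mul, Finset.abs_prod, Fin.prod_univ_castSucc]
    simp only [Fin.val_castSucc, Fin.val_last]
    have : (n.factorial : ℝ) ≠ 0 := by positivity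
    simp only [hμ, hz]
    field_simp

theorem norm_det_exp_le {n : ℕ} (x y : Fin n → ℝ) :
    ‖(Matrix.of fun i j => Complex.exp (x i * y j * Complex.I)).det‖ ≤
      |(vandermonde x).det| * |(vandermonde y).det| / ∏ i : Fin n, ((i : ℕ).factorial : ℝ) := by
  have h := norm_det_exp_le_of_monotone (x ∘ Tuple.sort x) y (Tuple.monotone_sort x)
  have h1 : (Matrix.of fun i j => Complex.exp ((x ∘ Tuple.sort x) i * y j * Complex.I)) =
    (Matrix.of fun i j => Complex.exp (x i * y j * Complex.I)).submatrix (Tuple.sort x) id := rfl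
  have h2 : vandermonde (x ∘ Tuple.sort x) = (vandermonde x).submatrix (Tuple.sort x) id := rfl
  have h3 : ∀ (σ : Equiv.Perm (Fin n)), ‖(((Equiv.Perm.sign σ : ℤˣ) : ℤ) : ℂ)‖ = 1 := by
    intro σ
    rcases Int.units_eq_one_or (Equiv.Perm.sign σ) with h | h <;> simp [h]
  rw [h1, det_permute, norm_mul, h3, one_mul] at h
  refine h.trans ?_
  gcongr
  refine (le_abs_self _).trans_eq ?_
  rw [h2, det_permute, abs_mul]
  rcases Int.units_eq_one_or (Equiv.Perm.sign (Tuple.sort x)) with h | h <;> simp [h]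

/-! ### Upper bound -/

theorem cConst_eq_prod (n : ℕ) : cConst n = ∏ i : Fin n, ((i : ℕ).factorial : ℝ) := by
  rw [Fin.prod_univ_eq_prod_range (fun i : ℕ => (i.factorial : ℝ)), cConst]
  cases n with
  | zero => simp
  | succ n =>
    rw [Finset.prod_range_succ', Nat.add_sub_cancel, Nat.factorial_zero, Nat.cast_one, mul_one,
      Finset.range_eq_Ico, Finset.prod_Ico_add' (fun i : ℕ => (i.factorial : ℝ)) 0 n 1]
    rfl

theorem vandermondePoly_eq_det {n : ℕ} (t : Fin n → ℝ) :
    vandermondePoly t = (vandermonde t).det :=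
  (det_vandermonde t).symm

theorem prod_pow_fin_val {R : Type*} [CommMonoid R] (n : ℕ) (a : R) :
    ∏ i : Fin n, a ^ (i : ℕ) = a ^ n.choose 2 := by
  rw [Finset.prod_pow_eq_pow_sum, Fin.sum_univ_eq_sum_range (fun i : ℕ => i), Finset.sum_range_id,
    Nat.choose_two_right]

theorem det_vandermonde_const_mul {R : Type*} [CommRing R] {n : ℕ} (a : R) (t : Fin n → R) :
    (vandermonde fun i => a * t i).det = a ^ n.choose 2 * (vandermonde t).det := by
  rw [← prod_pow_fin_val, ← det_mul_row]
  congr 1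
  ext i j
  simp [vandermonde_apply, mul_pow]

/-- The Gaussian matrix is the Gram matrix of characters in `L²` of the standard Gaussian. -/
theorem det_gaussianMatrix_le {n : ℕ} (t : Fin n → ℝ) {lam : ℝ} (hlam : 0 ≤ lam) :
    (gaussianMatrix lam t).det ≤ lam ^ (n.choose 2) / cConst n * vandermondePoly t ^ 2 := by
  set γ := gaussianReal 0 1
  set c : ℝ := ∏ i : Fin n, ((i : ℕ).factorial : ℝ) with hc
  have hc0 : 0 < c := Finset.prod_pos fun i _ => by positivity
  set y : Fin n → ℝ := fun i => √lam * t i with hy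
  let f : Fin n → ℝ → ℂ := fun j x => Complex.exp (x * y j * Complex.I)
  let g : Fin n → ℝ → ℂ := fun j x => Complex.exp (x * (-y j : ℝ) * Complex.I)
  have hfg : ∀ i j x, f i x * g j x = Complex.exp ((y i - y j : ℝ) * x * Complex.I) := by
    intro i j x
    simp only [f, g, ← Complex.exp_add]
    congr 1; push_cast; ring
  have hInt : ∀ i j, Integrable (fun x => f i x * g j x) γ := by
    intro i j
    simp_rw [hfg]
    refine (integrable_const (1 : ℝ)).mono' (by fun_prop) (.of_forall fun x => ?_)
    rw [← Complex.ofReal_mul, Complex.norm_exp_ofReal_mul_I]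
  have hA := integral_det_mul_det γ f g hInt
  -- The entries are values of the Gaussian characteristic function at y_i - y_j.
  have hM : (Matrix.of fun i j => ∫ x, f i x * g j x ∂γ) =
      (gaussianMatrix lam t).map Complex.ofRealHom := by
    ext i j
    simp_rw [of_apply, hfg]
    rw [← charFun_apply_real, charFun_gaussianReal]
    simp only [gaussianMatrix, map_apply, of_apply, Complex.ofRealHom_eq_coe, Complex.ofReal_exp]
    congr 1
    have : (y i - y j) ^ 2 = lam * (t j - t i) ^ 2 := by
      rw [hy, ← mul_sub, mul_pow, Real.sq_sqrt hlam]; ring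
    have h' : ((y i - y j : ℝ) : ℂ) ^ 2 = lam * (t j - t i) ^ 2 := by exact_mod_cast this
    rw [h']
    push_cast
    ring
  rw [hM, ← RingHom.mapMatrix_apply, ← RingHom.map_det, Fintype.card_fin] at hA
  have hb : ∀ s : Fin n → ℝ, ‖(Matrix.of fun i j => f j (s i)).det *
      (Matrix.of fun i j => g j (s i)).det‖ ≤
      (vandermonde s).det ^ 2 * ((vandermonde y).det ^ 2 / c ^ 2) := by
    intro s
    have h1 := norm_det_exp_le s y
    have h2 := norm_det_exp_le s (fun j => -y j)
    have h3 : |(vandermonde fun j => -y j).det| = |(vandermonde y).det| := by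
      have := det_vandermonde_const_mul (-1) y
      simp only [neg_one_mul] at this
      rw [this, abs_mul]; simp
    rw [h3] at h2
    rw [norm_mul]
    refine (mul_le_mul h1 h2 (norm_nonneg _) (by positivity)).trans_eq ?_
    rw [← sq_abs (vandermonde s).det, ← sq_abs (vandermonde y).det, ← hc]
    field_simp
  obtain ⟨hVi, hV⟩ := integral_det_vandermonde_sq n
  have hle := norm_integral_le_of_norm_le (hVi.mul_const _) (.of_forall hb)
  rw [hA.2, integral_mul_const, hV, norm_mul, Complex.norm_natCast, Complex.ofRealHom_eq_coe,
    Complex.norm_real] at hle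
  have hn : (0 : ℝ) < n.factorial := by positivity
  have hy2 : (vandermonde y).det ^ 2 = lam ^ n.choose 2 * vandermondePoly t ^ 2 := by
    rw [hy, det_vandermonde_const_mul, vandermondePoly_eq_det, mul_pow, ← pow_mul, mul_comm _ 2,
      pow_mul, Real.sq_sqrt hlam]
  rw [mul_assoc, mul_le_mul_iff_right₀ hn, ← hc] at hle
  refine (le_abs_self _).trans (hle.trans_eq ?_)
  rw [hy2, cConst_eq_prod, ← hc]
  field_simp

/-! ### Lower bound -/

/-- Factoring out M and Mᵀ leaves 1 + Q with Q = M⁻¹P(M⁻¹)ᵀ positive semidefinite. -/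
theorem Matrix.PosSemidef.det_mul_transpose_le {ι : Type*} [Fintype ι] [DecidableEq ι]
    {P M : Matrix ι ι ℝ} (hP : P.PosSemidef) (hM : IsUnit M.det) :
    (M * Mᵀ).det ≤ (M * Mᵀ + P).det := by
  have hQ := hP.mul_mul_conjTranspose_same M⁻¹
  have h : M * Mᵀ + P = M * (1 + M⁻¹ * P * M⁻¹ᴴ) * Mᵀ := by
    have h1 : M⁻¹ᴴ * Mᵀ = 1 := by
      rw [conjTranspose_eq_transpose_of_trivial, ← transpose_mul, mul_nonsing_inv _ hM,
        transpose_one]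
    rw [mul_add, add_mul, mul_one]
    congr 1
    rw [mul_assoc, mul_assoc (_ * _), h1, mul_one, ← mul_assoc, mul_nonsing_inv _ hM, one_mul]
  rw [h, det_mul, det_mul, det_mul, det_transpose]
  nlinarith [hQ.one_le_det_one_add, mul_self_nonneg M.det]

theorem le_det_exp_mul {n : ℕ} (u : Fin n → ℝ) (hu : Function.Injective u) {lam : ℝ}
    (hlam : 0 < lam) :
    lam ^ (n.choose 2) / cConst n * vandermondePoly u ^ 2 ≤
      (Matrix.of fun i j => Real.exp (lam * (u i * u j))).det := by
  let M : Matrix (Fin n) (Fin n) ℝ := Matrix.of fun i k =>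
    √(lam ^ (k : ℕ) / (k : ℕ).factorial) * vandermonde u i k
  have hMdet : M.det = (∏ k : Fin n, √(lam ^ (k : ℕ) / (k : ℕ).factorial)) * (vandermonde u).det :=
    det_mul_row _ _
  have hMunit : IsUnit M.det := by
    rw [isUnit_iff_ne_zero, hMdet]
    exact mul_ne_zero (Finset.prod_ne_zero_iff.2 fun k _ => by positivity)
      (det_vandermonde_ne_zero_iff.2 hu)
  let E : Matrix (Fin n) (Fin n) ℝ := Matrix.of fun i j => Real.exp (lam * (u i * u j))
  have hMM : ∀ i j, (M * Mᵀ) i j =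
      ∑ k ∈ Finset.range n, lam ^ k / k.factorial * (u i ^ k * u j ^ k) := by
    intro i j
    rw [← Fin.sum_univ_eq_sum_range
      (fun k : ℕ => lam ^ k / k.factorial * (u i ^ k * u j ^ k)), mul_apply]
    refine Finset.sum_congr rfl fun k _ => ?_
    have : √(lam ^ (k : ℕ) / (k : ℕ).factorial) ^ 2 = lam ^ (k : ℕ) / (k : ℕ).factorial :=
      Real.sq_sqrt (by positivity)
    simp only [M, transpose_apply, of_apply, vandermonde_apply]
    linear_combination u i ^ (k : ℕ) * u j ^ (k : ℕ) * this
  have hP : (E - M * Mᵀ).PosSemidef := by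
    refine .of_dotProduct_mulVec_nonneg ?_ fun x => ?_
    · ext i j
      simp [E, hMM, mul_comm (u j), mul_comm (u j ^ _)]
    -- The quadratic form of E is a series of nonnegative squares; its first n terms are the form of
    -- M Mᵀ.
    · have hs : HasSum (fun k : ℕ => lam ^ k / k.factorial * (∑ i, x i * u i ^ k) ^ 2)
          (x ⬝ᵥ E *ᵥ x) := by
        have h1 : ∀ i j, HasSum (fun k : ℕ => x i * (lam ^ k / k.factorial *
            (u i ^ k * u j ^ k) * x j)) (x i * (E i j * x j)) := by
          intro i j
          refine ((HasSum.mul_right _ ?_).mul_left _)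
          have := NormedSpace.expSeries_div_hasSum_exp (lam * (u i * u j))
          rw [← Real.exp_eq_exp_ℝ] at this
          have hk : (fun k : ℕ => lam ^ k / k.factorial * (u i ^ k * u j ^ k)) =
              fun k : ℕ => (lam * (u i * u j)) ^ k / k.factorial := by
            ext k
            rw [mul_pow, mul_pow]
            ring
          rw [hk]
          exact this
        have h2 := hasSum_sum fun i (_ : i ∈ Finset.univ) => hasSum_sum fun j
          (_ : j ∈ Finset.univ) => h1 i j
        convert h2 using 1
        · ext k
          rw [sq, Finset.sum_mul_sum, Finset.mul_sum]
          refine Finset.sum_congr rfl fun i _ => ?_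
          rw [Finset.mul_sum]
          refine Finset.sum_congr rfl fun j _ => ?_
          ring
        · simp [dotProduct, mulVec, Finset.mul_sum]
      have hle := sum_le_hasSum (Finset.range n) (fun k _ => by positivity) hs
      rw [sub_mulVec, dotProduct_sub, star_trivial, sub_nonneg]
      refine le_trans (le_of_eq ?_) hle
      simp only [dotProduct, mulVec, hMM, Finset.mul_sum, Finset.sum_mul]
      simp_rw [Finset.sum_comm (t := Finset.range n)]
      refine Finset.sum_congr rfl fun k _ => ?_
      rw [sq, Finset.sum_mul_sum, Finset.mul_sum]
      refine Finset.sum_congr rfl fun i _ => ?_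
      rw [Finset.mul_sum]
      refine Finset.sum_congr rfl fun j _ => ?_
      ring
  have hdet := hP.det_mul_transpose_le hMunit
  rw [add_sub_cancel] at hdet
  refine le_trans (le_of_eq ?_) hdet
  rw [det_mul, det_transpose, hMdet, vandermondePoly_eq_det, cConst_eq_prod, ← prod_pow_fin_val,
    ← Finset.prod_div_distrib, ← sq, mul_pow, ← Finset.prod_pow]
  congr 1
  exact Finset.prod_congr rfl fun k _ => (Real.sq_sqrt (by positivity)).symm

theorem le_det_gaussianMatrix {n : ℕ} (t : Fin n → ℝ) (ht : Function.Injective t) {lam : ℝ}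
    (hlam : 0 < lam) :
    lam ^ (n.choose 2) / cConst n * vandermondePoly t ^ 2 * Real.exp (-lam * sumSqDev t)
      ≤ (gaussianMatrix lam t).det := by
  set u : Fin n → ℝ := fun i => t i - nodeMean t with hu
  have h := le_det_exp_mul u (fun i j hij => ht (by simpa [hu] using hij)) hlam
  have hV : vandermondePoly u = vandermondePoly t := by
    rw [vandermondePoly_eq_det, vandermondePoly_eq_det, hu, det_vandermonde_sub]
  let d : Fin n → ℝ := fun i => Real.exp (-lam * u i ^ 2 / 2)
  have hB : (gaussianMatrix lam t).det = (∏ i, d i) * ((∏ i, d i) *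
      (Matrix.of fun i j => Real.exp (lam * (u i * u j))).det) := by
    rw [← det_mul_row, ← det_mul_column]
    congr 1
    ext i j
    simp only [gaussianMatrix, of_apply, d, ← Real.exp_add, hu]
    congr 1; ring
  have hd : (∏ i, d i) * ∏ i, d i = Real.exp (-lam * sumSqDev t) := by
    rw [← Finset.prod_mul_distrib, sumSqDev, Finset.mul_sum, Real.exp_sum]
    refine Finset.prod_congr rfl fun i _ => ?_
    rw [← Real.exp_add]; congr 1; simp only [hu]; ring
  rw [hB, ← mul_assoc, hd, mul_comm, ← hV]
  gcongr

theorem corollary1 (n : ℕ) (t : Fin n → ℝ) (ht : Function.Injective t)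
    (lam : ℝ) (hlam : 0 < lam) :
    lam ^ (n.choose 2) / cConst n * vandermondePoly t ^ 2 * Real.exp (-lam * sumSqDev t)
        ≤ (gaussianMatrix lam t).det ∧
      (gaussianMatrix lam t).det ≤ lam ^ (n.choose 2) / cConst n * vandermondePoly t ^ 2 := by
  exact ⟨le_det_gaussianMatrix t ht hlam, det_gaussianMatrix_le t hlam.le⟩
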